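/- There are $m$ owners and $n$ items, and every owner owns every item (completely overlapping ownership). The items have ground-truth scores $R\in\mathbb{R}^n$. The raw review scores are $y=R+z$, where the random noise vector $z=(z_1,\dots,z_n)$ is exchangeable: $(z_{\rho(1)},\dots,z_{\rho(n)})$ has the same distribution as $z$ for every permutation $\rho$ of $\{1,\dots,n\}$. For a ranking (permutation) $\pi$ of the items let $\hat R(\pi;y)$ be the isotonic regression of $y$ under $\pi$, that is, the unique minimizer of $\|y-r\|_2^2$ over all $r\in\mathbb{R}^n$ with $r_{\pi(1)}\ge r_{\pi(2)}\ge\dots\ge r_{\pi(n)}$. Owner $j$ has a credential $\alpha^j\in[0,1]$, with $\sum_{j}\alpha^j>0$. Each owner $j$ reports a ranking $\pi^j$ of the $n$ items before the review scores are realized, and the mechanism outputs the adjusted scores $$\hat R(\pi^1,\dots,\pi^m;y)=\frac{\sum_{j=1}^m\alpha^j\,\hat R(\pi^j;y)}{\sum_{j=1}^m\alpha^j}.$$ Owner $j$'s utility from adjusted scores $r$ is $\sum_{i=1}^n U^j(r_i)$, where $U^j:\mathbb{R}\to\mathbb{R}$ is convex and non-decreasing; assume that for every profile of reports every owner's utility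 is integrable, and write $u^j(\pi^1,\dots,\pi^m)=\mathbb{E}_z\big[\sum_{i=1}^n U^j(\hat R_i(\pi^1,\dots,\pi^m;R+z))\big]$. A mixed strategy is a probability distribution over rankings; under a mixed profile the owners draw their reports independently of each other and of $z$, and expected utilities are taken over these draws as well. A profile (pure or mixed) is a Bayes–Nash equilibrium if no owner can increase her expected utility by changing her own report (or distribution of reports) while the others keep theirs. Let $\pi^\star$ be a true ranking, $R_{\pi^\star(1)}\ge R_{\pi^\star(2)}\ge\dots\ge R_{\pi^\star(n)}$, known to all owners (if ground-truth scores are tied there are several true rankings, and $\pi^\star$ is any one of them, common to all owners). Then: 1. The profile $(\pi^\star,\dots,\pi^\star)$, in which every owner reports truthfully, is a Bayes–Nash equilibrium. 2. This equilibrium is payoff dominant: it is also an equilibrium against mixed deviations, and in every (possibly mixed) Bayes–Nash equilibrium each owner $j$ has expected utility at most $u^j(\pi^\star,\dots,\pi^\star)$. -/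

import Mathlib

open MeasureTheory

/-- Score vectors that respect the ranking `π`: `r_{π(1)} ≥ r_{π(2)} ≥ ⋯ ≥ r_{π(n)}`.
Here `π k` is the item that `π` puts in position `k` (best item first). -/
def isotonicCone {n : ℕ} (π : Equiv.Perm (Fin n)) : Set (Fin n → ℝ) :=
  {r | Antitone (fun k => r (π k))}

/-- `r` solves the convex program: minimise the squared Euclidean distance `‖y - r‖²`
subject to `r` respecting the ranking `π`. -/
def IsIsotonicRegression {n : ℕ} (π : Equiv.Perm (Fin n)) (y r : Fin n → ℝ) : Prop :=
  r ∈ isotonicCone π ∧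
    ∀ s ∈ isotonicCone π, ∑ i, (y i - r i) ^ 2 ≤ ∑ i, (y i - s i) ^ 2

/-- The isotonic regression problem has exactly one solution. -/
theorem existsUnique_isIsotonicRegression {n : ℕ} (π : Equiv.Perm (Fin n)) (y : Fin n → ℝ) :
    ∃! r, IsIsotonicRegression π y r := by
  have hex : ∃ r, IsIsotonicRegression π y r := by
    let K : Set (EuclideanSpace ℝ (Fin n)) := {v | Antitone (fun k => v (π k))}
    have hne : K.Nonempty := ⟨0, fun a b _ => by simp⟩
    have hcl : IsClosed K := by
      have : K = ⋂ a, ⋂ b, ⋂ (_ : a ≤ b), {v | v (π b) ≤ v (π a)} := by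
        ext v; simp [K, Antitone]
      rw [this]
      exact isClosed_iInter fun a => isClosed_iInter fun b => isClosed_iInter fun _ =>
        isClosed_le (by fun_prop) (by fun_prop)
    have hconv : Convex ℝ K := by
      intro v hv w hw a b ha hb _ k l hkl
      have h1 := mul_le_mul_of_nonneg_left (hv hkl) ha
      have h2 := mul_le_mul_of_nonneg_left (hw hkl) hb
      simpa using add_le_add h1 h2
    obtain ⟨v, hvK, hv⟩ :=
      exists_norm_eq_iInf_of_complete_convex hne hcl.isComplete hconv (WithLp.toLp 2 y)
    refine ⟨fun i => v i, hvK, fun s hs => ?_⟩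
    have hle : ‖WithLp.toLp 2 y - v‖ ≤ ‖WithLp.toLp 2 y - WithLp.toLp 2 s‖ := by
      rw [hv]
      exact ciInf_le (f := fun w : K => ‖WithLp.toLp 2 y - (w : EuclideanSpace ℝ (Fin n))‖)
        ⟨0, by rintro _ ⟨w, rfl⟩; exact norm_nonneg _⟩ ⟨WithLp.toLp 2 s, hs⟩
    have hsq := pow_le_pow_left₀ (norm_nonneg _) hle 2
    simpa [EuclideanSpace.real_norm_sq_eq] using hsq
  obtain ⟨r, hr⟩ := hex
  refine ⟨r, hr, fun s hs => ?_⟩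
  have hmid : (fun i => (r i + s i) / 2) ∈ isotonicCone π := fun k l hkl => by
    have h1 := hr.1 hkl
    have h2 := hs.1 hkl
    simp only at h1 h2 ⊢
    linarith
  have h1 := hr.2 _ hmid
  have h2 := hs.2 _ hmid
  have hpar : ∑ i, (y i - (r i + s i) / 2) ^ 2 = (∑ i, (y i - r i) ^ 2) / 2
      + (∑ i, (y i - s i) ^ 2) / 2 - (∑ i, (s i - r i) ^ 2) / 4 := by
    rw [Finset.sum_div, Finset.sum_div, Finset.sum_div, ← Finset.sum_add_distrib,
      ← Finset.sum_sub_distrib]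
    exact Finset.sum_congr rfl fun i _ => by ring
  have h0 : ∑ i, (s i - r i) ^ 2 = 0 :=
    le_antisymm (by linarith) (Finset.sum_nonneg fun i _ => sq_nonneg _)
  funext i
  have := (Finset.sum_eq_zero_iff_of_nonneg fun i _ => sq_nonneg (s i - r i)).1 h0 i
    (Finset.mem_univ i)
  exact sub_eq_zero.1 (pow_eq_zero_iff two_ne_zero |>.1 this)

/-- The rank-calibrated scores: the unique solution of the isotonic regression of the
review scores `y` under the ranking `π`. -/
noncomputable def isotonicRegression {n : ℕ} (π : Equiv.Perm (Fin n)) (y : Fin n → ℝ) :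
    Fin n → ℝ :=
  (existsUnique_isIsotonicRegression π y).choose

/-- The defining property of `isotonicRegression`. -/
theorem isIsotonicRegression_isotonicRegression {n : ℕ} (π : Equiv.Perm (Fin n))
    (y : Fin n → ℝ) : IsIsotonicRegression π y (isotonicRegression π y) :=
  (existsUnique_isIsotonicRegression π y).choose_spec.1

/-- The mechanism: the credential-weighted average, over the owners, of the isotonic
regressions of the review scores `y` under the rankings that the owners report. -/
noncomputable def isotonicMechanism {m n : ℕ} (α : Fin m → ℝ)
    (π : Fin m → Equiv.Perm (Fin n)) (y : Fin n → ℝ) : Fin n → ℝ :=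
  fun i => (∑ j, α j * isotonicRegression (π j) y i) / ∑ j, α j

/-- The noise vector has the same law as each of its coordinate permutations. -/
def IsExchangeable {Ω : Type*} [MeasurableSpace Ω] {n : ℕ} (P : Measure Ω)
    (z : Ω → Fin n → ℝ) : Prop :=
  ∀ ρ : Equiv.Perm (Fin n), P.map (fun ω i => z ω (ρ i)) = P.map z

/-- The data of a review problem with `m` owners and `n` items. No assumption is made on them
here. -/
structure ReviewProblem (Ω : Type*) (m n : ℕ) where
  /-- the set of items of each owner -/
  owned : Fin m → Finset (Fin n)
  /-- the ground-truth scores -/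
  truth : Fin n → ℝ
  /-- the review noise -/
  noise : Ω → Fin n → ℝ
  /-- the owners' credentials -/
  credential : Fin m → ℝ
  /-- the one-item utility function of each owner -/
  itemUtility : Fin m → ℝ → ℝ

namespace ReviewProblem

variable {Ω : Type*} {m n : ℕ} (G : ReviewProblem Ω m n)

/-- Every owner owns every item. -/
def CompletelyOverlapping : Prop :=
  ∀ j, G.owned j = Finset.univ

/-- `π` is a true ranking: it lists the items in non-increasing order of ground-truth score. -/
def IsTrueRanking (π : Equiv.Perm (Fin n)) : Prop :=
  Antitone (fun k => G.truth (π k))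

/-- The raw review scores, ground truth plus noise. -/
def rawScores (ω : Ω) : Fin n → ℝ :=
  fun i => G.truth i + G.noise ω i

/-- The utility of owner `j` from adjusted scores `r`: the sum of her one-item utilities
over the items she owns. -/
def utility (j : Fin m) (r : Fin n → ℝ) : ℝ :=
  ∑ i ∈ G.owned j, G.itemUtility j (r i)

/-- The utility of owner `j` at the outcome `ω` of the reviews, when the owners report `π`. -/
noncomputable def realizedUtility (π : Fin m → Equiv.Perm (Fin n)) (j : Fin m) (ω : Ω) : ℝ :=
  G.utility j (isotonicMechanism G.credential π (G.rawScores ω))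

variable [MeasurableSpace Ω] (P : Measure Ω)

/-- Expected utility of owner `j` when the owners report the rankings `π`. -/
noncomputable def expectedUtility (π : Fin m → Equiv.Perm (Fin n)) (j : Fin m) : ℝ :=
  ∫ ω, G.realizedUtility π j ω ∂P

/-- Bayes-Nash equilibrium in pure strategies: no owner gains by reporting another ranking. -/
def IsBayesNash (π : Fin m → Equiv.Perm (Fin n)) : Prop :=
  ∀ (j : Fin m) (π' : Equiv.Perm (Fin n)),
    G.expectedUtility P (Function.update π j π') j ≤ G.expectedUtility P π j

/-- Expected utility of owner `j` when the owners draw their reports independently,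
owner `k` from the distribution `x k` over rankings. -/
noncomputable def mixedExpectedUtility (x : Fin m → stdSimplex ℝ (Equiv.Perm (Fin n)))
    (j : Fin m) : ℝ :=
  ∫ ω, ∑ π : Fin m → Equiv.Perm (Fin n),
    (∏ k, (x k : Equiv.Perm (Fin n) → ℝ) (π k)) * G.realizedUtility π j ω ∂P

/-- Bayes-Nash equilibrium in mixed strategies. -/
def IsMixedBayesNash (x : Fin m → stdSimplex ℝ (Equiv.Perm (Fin n))) : Prop :=
  ∀ (j : Fin m) (x' : stdSimplex ℝ (Equiv.Perm (Fin n))),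
    G.mixedExpectedUtility P (Function.update x j x') j ≤ G.mixedExpectedUtility P x j

/-- The profile `π` of reports, played with probability one, is a payoff-dominant equilibrium:
it is an equilibrium, also against mixed deviations, and no equilibrium, pure or mixed, gives
any owner a higher expected utility. -/
def IsPayoffDominant (π : Fin m → Equiv.Perm (Fin n)) : Prop :=
  G.IsMixedBayesNash P (fun j => ⟨Pi.single (π j) 1, single_mem_stdSimplex ℝ (π j)⟩) ∧
  ∀ x : Fin m → stdSimplex ℝ (Equiv.Perm (Fin n)), G.IsMixedBayesNash P x →
    ∀ j, G.mixedExpectedUtility P x j ≤ G.expectedUtility P π j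

end ReviewProblem

/-! Common truth-telling maximises each owner's expected utility over all profiles, which yields
both claims. By Jensen, the utility of the averaged scores is at most the credential-weighted
average of the utilities under unanimous reports, so unanimous profiles suffice
(`realizedUtility_le_sum`).

If all report `π`, relabelling items by `π` turns the scores into the regression of `R ∘ π + z ∘ π`
in the identity order. Exchangeability replaces `z ∘ π` by `z` in expectation, so all rankings face
the same noise and can be compared pointwise. By rearrangement, sorting `R` makes `R ∘ π + z`
largest against every antitone weight. Projection onto the isotonic cone turns this order into an
inequality of convex sums (`sum_convex_isotonicRegression_le`): weighting by the slopes of `U` at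
the fitted values, the polar and orthogonality conditions control the residuals. -/

open Filter Topology

/-! ### Isotonic regression as projection onto a cone -/

section FirstOrderConditions

variable {n : ℕ} {π : Equiv.Perm (Fin n)} {y r : Fin n → ℝ}

/-- First-order optimality condition of the isotonic regression along a feasible direction. -/
theorem IsIsotonicRegression.sum_mul_nonpos_of_eventually (h : IsIsotonicRegression π y r)
    {d : Fin n → ℝ} (hd : ∀ᶠ t : ℝ in 𝓝[>] 0, (fun i => r i + t * d i) ∈ isotonicCone π) :
    ∑ i, (y i - r i) * d i ≤ 0 := by
  set A := ∑ i, (y i - r i) * d i with hA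
  set B := ∑ i, d i ^ 2 with hB
  have key : ∀ᶠ t : ℝ in 𝓝[>] 0, 2 * A ≤ t * B := by
    filter_upwards [hd, self_mem_nhdsWithin] with t ht ht0
    have ht0 : 0 < t := ht0
    have h1 := h.2 _ ht
    have h2 : ∑ i, (y i - (r i + t * d i)) ^ 2
        = ∑ i, (y i - r i) ^ 2 - t * (2 * A) + t * (t * B) := by
      rw [hA, hB, Finset.mul_sum, Finset.mul_sum, Finset.mul_sum, Finset.mul_sum,
        ← Finset.sum_sub_distrib, ← Finset.sum_add_distrib]
      exact Finset.sum_congr rfl fun i _ => by ring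
    exact le_of_mul_le_mul_left (by linarith) ht0
  have hlim : Tendsto (fun t : ℝ => t * B) (𝓝[>] 0) (𝓝 0) := by
    have : Tendsto (fun t : ℝ => t * B) (𝓝 0) (𝓝 (0 * B)) := tendsto_id.mul_const B
    rw [zero_mul] at this
    exact this.mono_left nhdsWithin_le_nhds
  have := ge_of_tendsto hlim key
  linarith

/-- The residual of the isotonic regression lies in the polar of the isotonic cone. -/
theorem IsIsotonicRegression.sum_mul_nonpos (h : IsIsotonicRegression π y r) {d : Fin n → ℝ}
    (hd : d ∈ isotonicCone π) : ∑ i, (y i - r i) * d i ≤ 0 := by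
  refine h.sum_mul_nonpos_of_eventually ?_
  filter_upwards [self_mem_nhdsWithin] with t ht k l hkl
  exact add_le_add (h.1 hkl) (mul_le_mul_of_nonneg_left (hd hkl) (le_of_lt ht))

/-- The residual of the isotonic regression is orthogonal to every monotone function of the
fitted values. -/
theorem IsIsotonicRegression.sum_mul_monotone_eq_zero (h : IsIsotonicRegression π y r)
    {φ : ℝ → ℝ} (hφ : Monotone φ) : ∑ i, (y i - r i) * φ (r i) = 0 := by
  refine le_antisymm (h.sum_mul_nonpos fun k l hkl => hφ (h.1 hkl)) ?_
  -- The direction `-φ ∘ r` need not lie in the cone, but small steps along it are feasible: tied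
  -- fitted values stay tied, and strict gaps survive for small `t`.
  have hneg : ∑ i, (y i - r i) * (-φ (r i)) ≤ 0 := by
    refine h.sum_mul_nonpos_of_eventually ?_
    have hev : ∀ k l, ∀ᶠ t : ℝ in 𝓝[>] 0, k ≤ l →
        r (π l) + t * (-φ (r (π l))) ≤ r (π k) + t * (-φ (r (π k))) := by
      intro k l
      by_cases hkl : k ≤ l
      · rcases (h.1 hkl).eq_or_lt with heq | hlt
        · have heq : r (π l) = r (π k) := heq
          exact Eventually.of_forall fun t _ => by rw [heq]
        · have hlim (x : ℝ) :
              Tendsto (fun t : ℝ => x + t * (-φ x)) (𝓝[>] 0) (𝓝 x) := by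
            have hc : Continuous fun t : ℝ => x + t * (-φ x) := by fun_prop
            have := hc.tendsto 0
            rw [zero_mul, add_zero] at this
            exact this.mono_left nhdsWithin_le_nhds
          filter_upwards [(hlim (r (π l))).eventually_lt (hlim (r (π k))) hlt] with t ht _
          exact ht.le
      · exact Eventually.of_forall fun t h' => absurd h' hkl
    filter_upwards [eventually_all.2 fun k => eventually_all.2 fun l => hev k l] with t ht k l hkl
    exact ht k l hkl
  simp only [mul_neg, Finset.sum_neg_distrib] at hneg
  linarith

/-- The isotonic regression is non-expansive in the Euclidean distance. -/
theorem sum_sq_sub_isotonicRegression_le (π : Equiv.Perm (Fin n)) (y y' : Fin n → ℝ) :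
    ∑ i, (isotonicRegression π y i - isotonicRegression π y' i) ^ 2
      ≤ ∑ i, (y i - y' i) ^ 2 := by
  have h := isIsotonicRegression_isotonicRegression π y
  have h' := isIsotonicRegression_isotonicRegression π y'
  set r := isotonicRegression π y
  set r' := isotonicRegression π y'
  have e1 := h.sum_mul_nonpos h'.1
  have e2 := h'.sum_mul_nonpos h.1
  have e3 := h.sum_mul_monotone_eq_zero monotone_id
  have e4 := h'.sum_mul_monotone_eq_zero monotone_id
  -- Split `y - y'` into `r - r'` plus the difference of residuals; the cross term is nonnegative by
  -- `e1`–`e4`.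
  have hsum : ∑ i, (y i - y' i) ^ 2 - ∑ i, (r i - r' i) ^ 2
      = ∑ i, ((y i - y' i) - (r i - r' i)) ^ 2
        + 2 * (∑ i, (y i - r i) * id (r i) + ∑ i, (y' i - r' i) * id (r' i)
          - ∑ i, (y i - r i) * r' i - ∑ i, (y' i - r' i) * r i) := by
    simp only [← Finset.sum_sub_distrib, ← Finset.sum_add_distrib, Finset.mul_sum, id]
    exact Finset.sum_congr rfl fun i _ => by ring
  have := Finset.sum_nonneg fun i (_ : i ∈ Finset.univ) =>
    sq_nonneg ((y i - y' i) - (r i - r' i))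
  linarith

/-- Follows from non-expansiveness; it supplies the measurability needed to integrate against the
law of the noise. -/
theorem continuous_isotonicRegression (π : Equiv.Perm (Fin n)) :
    Continuous (isotonicRegression π) := by
  refine continuous_pi fun i => continuous_iff_continuousAt.2 fun y => ?_
  have hc : Continuous fun w : Fin n → ℝ => √(∑ k, (w k - y k) ^ 2) := by fun_prop
  have hlim := hc.tendsto y
  simp only [sub_self, ne_eq, OfNat.ofNat_ne_zero, not_false_eq_true, zero_pow,
    Finset.sum_const_zero, Real.sqrt_zero] at hlim
  refine tendsto_iff_dist_tendsto_zero.2 (squeeze_zero (fun _ => dist_nonneg) (fun w => ?_) hlim)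
  rw [Real.dist_eq]
  refine Real.abs_le_sqrt (le_trans ?_ (sum_sq_sub_isotonicRegression_le π w y))
  exact Finset.single_le_sum
    (f := fun k => (isotonicRegression π w k - isotonicRegression π y k) ^ 2)
    (fun k _ => sq_nonneg _) (Finset.mem_univ i)

/-- Isotonic regression under `π` is isotonic regression in the identity order of the relabelled
vector. -/
theorem isotonicRegression_apply_perm (π : Equiv.Perm (Fin n)) (y : Fin n → ℝ) (k : Fin n) :
    isotonicRegression π y (π k) = isotonicRegression 1 (fun l => y (π l)) k := by
  have h := isIsotonicRegression_isotonicRegression π y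
  have h' : IsIsotonicRegression 1 (fun l => y (π l)) fun l => isotonicRegression π y (π l) := by
    refine ⟨h.1, fun s hs => ?_⟩
    have := h.2 (fun i => s (π.symm i)) fun a b hab => by simpa using hs hab
    rw [← Equiv.sum_comp π, ← Equiv.sum_comp π fun i => (y i - s (π.symm i)) ^ 2] at this
    simpa using this
  exact congrFun ((existsUnique_isIsotonicRegression _ _).unique h'
    (isIsotonicRegression_isotonicRegression _ _)) k

theorem sum_isotonicRegression_eq (f : ℝ → ℝ) (π : Equiv.Perm (Fin n)) (y : Fin n → ℝ) :
    ∑ i, f (isotonicRegression π y i)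
      = ∑ k, f (isotonicRegression 1 (fun l => y (π l)) k) := by
  rw [← Equiv.sum_comp π]
  simp only [isotonicRegression_apply_perm]

end FirstOrderConditions

/-! ### Convex sums and majorization -/

/-- A convex function on the line lies above its right tangent lines. -/
theorem ConvexOn.add_rightDeriv_mul_le {f : ℝ → ℝ} (hf : ConvexOn ℝ Set.univ f) (x y : ℝ) :
    f x + derivWithin f (Set.Ioi x) x * (y - x) ≤ f y := by
  rcases lt_trichotomy x y with hxy | rfl | hxy
  · have h := hf.rightDeriv_le_slope_of_mem_interior (x := x) (by simp) (Set.mem_univ y) hxy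
    rw [slope_def_field, le_div_iff₀ (sub_pos.2 hxy)] at h
    linarith
  · simp
  · have h := (hf.slope_le_leftDeriv_of_mem_interior (Set.mem_univ y) (by simp) hxy).trans
      (hf.leftDeriv_le_rightDeriv_of_mem_interior (by simp))
    rw [slope_def_field, div_le_iff₀ (sub_pos.2 hxy)] at h
    linarith

theorem ConvexOn.monotone_rightDeriv {f : ℝ → ℝ} (hf : ConvexOn ℝ Set.univ f) :
    Monotone fun x => derivWithin f (Set.Ioi x) x := by
  have := hf.monotoneOn_rightDeriv
  rwa [interior_univ, monotoneOn_univ] at this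

theorem ConvexOn.continuous_of_univ {f : ℝ → ℝ} (hf : ConvexOn ℝ Set.univ f) :
    Continuous f :=
  continuousOn_univ.1 (hf.continuousOn isOpen_univ)

/-- If `a` dominates `b` against all antitone weights (majorization in the natural order), then
the isotonic regression of `a` majorizes that of `b`. -/
theorem sum_convex_isotonicRegression_le {n : ℕ} {U : ℝ → ℝ} (hU : ConvexOn ℝ Set.univ U)
    {a b : Fin n → ℝ} (hab : ∀ g : Fin n → ℝ, Antitone g → ∑ i, g i * b i ≤ ∑ i, g i * a i) :
    ∑ i, U (isotonicRegression 1 b i) ≤ ∑ i, U (isotonicRegression 1 a i) := by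
  have hp := isIsotonicRegression_isotonicRegression 1 a
  have hq := isIsotonicRegression_isotonicRegression 1 b
  set p := isotonicRegression 1 a
  set q := isotonicRegression 1 b
  -- `U` need not be differentiable; its right derivative is a monotone choice of subgradient, so `φ
  -- ∘ q` is an admissible antitone weight.
  let φ : ℝ → ℝ := fun x => derivWithin U (Set.Ioi x) x
  have hφ : Monotone φ := hU.monotone_rightDeriv
  have hg : Antitone fun i => φ (q i) := fun k l hkl => hφ (hq.1 hkl)
  have h1 := hp.sum_mul_nonpos (d := fun i => φ (q i)) hg
  have h2 := hq.sum_mul_monotone_eq_zero hφ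
  have h3 := hab _ hg
  have h4 : ∑ i, (U (q i) + φ (q i) * (p i - q i)) ≤ ∑ i, U (p i) :=
    Finset.sum_le_sum fun i _ => hU.add_rightDeriv_mul_le _ _
  have h5 : ∑ i, (U (q i) + φ (q i) * (p i - q i)) = ∑ i, U (q i)
      + (∑ i, φ (q i) * a i - ∑ i, φ (q i) * b i) + ∑ i, (b i - q i) * φ (q i)
      - ∑ i, (a i - p i) * φ (q i) := by
    simp only [← Finset.sum_sub_distrib, ← Finset.sum_add_distrib]
    exact Finset.sum_congr rfl fun i _ => by ring
  linarith

/-- The noise contributes equally to both sides of the majorization condition and cancels; what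
remains is the rearrangement inequality for `R`. -/
theorem sum_isotonicRegression_add_le {n : ℕ} {U : ℝ → ℝ} (hU : ConvexOn ℝ Set.univ U)
    {R : Fin n → ℝ} {ρ : Equiv.Perm (Fin n)} (hρ : Antitone fun k => R (ρ k))
    (π : Equiv.Perm (Fin n)) (z : Fin n → ℝ) :
    ∑ i, U (isotonicRegression 1 (fun k => R (π k) + z k) i)
      ≤ ∑ i, U (isotonicRegression 1 (fun k => R (ρ k) + z k) i) := by
  refine sum_convex_isotonicRegression_le hU fun g hg => ?_
  have hmono : Monovary g fun k => R (ρ k) := hg.monovary hρ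
  -- This `σ` satisfies `ρ (σ k) = π k`.
  have h := hmono.sum_mul_comp_perm_le_sum_mul (σ := π.trans ρ.symm)
  simp only [Equiv.trans_apply, Equiv.apply_symm_apply] at h
  simp only [mul_add, Finset.sum_add_distrib]
  linarith

/-! ### From unanimous to arbitrary and mixed profiles -/

namespace ReviewProblem

variable {Ω : Type*} {m n : ℕ} {G : ReviewProblem Ω m n}

theorem isotonicMechanism_const {α : Fin m → ℝ} (hα : 0 < ∑ j, α j) (π : Equiv.Perm (Fin n))
    (y : Fin n → ℝ) : isotonicMechanism α (fun _ => π) y = isotonicRegression π y := by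
  funext i
  rw [isotonicMechanism, ← Finset.sum_mul, mul_div_cancel_left₀ _ hα.ne']

theorem realizedUtility_const (hown : G.CompletelyOverlapping) (hα : 0 < ∑ j, G.credential j)
    (π : Equiv.Perm (Fin n)) (j : Fin m) (ω : Ω) :
    G.realizedUtility (fun _ => π) j ω
      = ∑ k, G.itemUtility j
          (isotonicRegression 1 (fun l => G.truth (π l) + G.noise ω (π l)) k) := by
  rw [realizedUtility, utility, hown j, isotonicMechanism_const hα, sum_isotonicRegression_eq]
  rfl

/-- By convexity, averaging the regressions does not exceed averaging the utilities. -/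
theorem realizedUtility_le_sum (hconv : ∀ j, ConvexOn ℝ Set.univ (G.itemUtility j))
    (h0 : ∀ j, 0 ≤ G.credential j) (hα : 0 < ∑ j, G.credential j)
    (π : Fin m → Equiv.Perm (Fin n)) (j : Fin m) (ω : Ω) :
    G.realizedUtility π j ω
      ≤ ∑ k, G.credential k / (∑ l, G.credential l) * G.realizedUtility (fun _ => π k) j ω := by
  simp only [realizedUtility, utility, isotonicMechanism_const hα, Finset.mul_sum]
  rw [Finset.sum_comm]
  refine Finset.sum_le_sum fun i _ => ?_
  have h := (hconv j).map_sum_le (t := Finset.univ)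
    (w := fun k => G.credential k / ∑ l, G.credential l)
    (p := fun k => isotonicRegression (π k) (G.rawScores ω) i)
    (fun k _ => div_nonneg (h0 k) hα.le) (by rw [← Finset.sum_div, div_self hα.ne'])
    (fun _ _ => Set.mem_univ _)
  simp only [smul_eq_mul] at h
  convert h using 2
  rw [isotonicMechanism, Finset.sum_div]
  exact Finset.sum_congr rfl fun k _ => by ring

variable [MeasurableSpace Ω] {P : Measure Ω}

/-- Both facts depend only on the law of the vector. The integrability part carries the assumption
on realized utilities, which involve permuted noise, over to unpermuted noise. -/
theorem integrable_and_integral_comp_perm {z : Ω → Fin n → ℝ} (hz : Measurable z)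
    (hexch : IsExchangeable P z) (ρ : Equiv.Perm (Fin n)) {f : (Fin n → ℝ) → ℝ}
    (hf : Continuous f) :
    (Integrable (fun ω => f fun i => z ω (ρ i)) P ↔ Integrable (fun ω => f (z ω)) P) ∧
      ∫ ω, f (fun i => z ω (ρ i)) ∂P = ∫ ω, f (z ω) ∂P := by
  have hz' : Measurable fun ω i => z ω (ρ i) :=
    measurable_pi_lambda _ fun i => (measurable_pi_apply (ρ i)).comp hz
  constructor
  · rw [← Function.comp_def f, ← Function.comp_def f,
      ← integrable_map_measure hf.aestronglyMeasurable hz'.aemeasurable,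
      ← integrable_map_measure hf.aestronglyMeasurable hz.aemeasurable, hexch ρ]
  · rw [← integral_map hz'.aemeasurable hf.aestronglyMeasurable,
      ← integral_map hz.aemeasurable hf.aestronglyMeasurable, hexch ρ]

/-- When all owners report the same ranking, a true one is the best for every owner. -/
theorem expectedUtility_const_le (hown : G.CompletelyOverlapping) (hnoise : Measurable G.noise)
    (hexch : IsExchangeable P G.noise) (hconv : ∀ j, ConvexOn ℝ Set.univ (G.itemUtility j))
    (hα : 0 < ∑ j, G.credential j) {ρ : Equiv.Perm (Fin n)} (hρ : G.IsTrueRanking ρ)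
    (hint : ∀ (π : Fin m → Equiv.Perm (Fin n)) (j : Fin m),
      Integrable (G.realizedUtility π j) P) (π : Equiv.Perm (Fin n)) (j : Fin m) :
    G.expectedUtility P (fun _ => π) j ≤ G.expectedUtility P (fun _ => ρ) j := by
  let f (σ : Equiv.Perm (Fin n)) (w : Fin n → ℝ) : ℝ :=
    ∑ k, G.itemUtility j (isotonicRegression 1 (fun l => G.truth (σ l) + w l) k)
  have hf (σ : Equiv.Perm (Fin n)) : Continuous (f σ) := by
    refine continuous_finsetSum _ fun k _ => (hconv j).continuous_of_univ.comp ?_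
    exact (continuous_apply k).comp ((continuous_isotonicRegression 1).comp (by fun_prop))
  have hreal (σ : Equiv.Perm (Fin n)) :
      G.realizedUtility (fun _ => σ) j = fun ω => f σ fun i => G.noise ω (σ i) :=
    funext fun ω => realizedUtility_const hown hα σ j ω
  have hint' (σ : Equiv.Perm (Fin n)) : Integrable (fun ω => f σ (G.noise ω)) P := by
    refine (integrable_and_integral_comp_perm hnoise hexch σ (hf σ)).1.1 ?_
    rw [← hreal]
    exact hint _ j
  simp only [expectedUtility, hreal,
    (integrable_and_integral_comp_perm hnoise hexch _ (hf _)).2]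
  -- Both integrands now see the same noise vector, so they compare at each `ω`.
  exact integral_mono (hint' π) (hint' ρ) fun ω => sum_isotonicRegression_add_le (hconv j) hρ π _

/-- No profile of reports gives any owner more than truthful reporting by everyone. -/
theorem expectedUtility_le_true (hown : G.CompletelyOverlapping) (hnoise : Measurable G.noise)
    (hexch : IsExchangeable P G.noise) (hconv : ∀ j, ConvexOn ℝ Set.univ (G.itemUtility j))
    (h0 : ∀ j, 0 ≤ G.credential j) (hα : 0 < ∑ j, G.credential j)
    {ρ : Equiv.Perm (Fin n)} (hρ : G.IsTrueRanking ρ)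
    (hint : ∀ (π : Fin m → Equiv.Perm (Fin n)) (j : Fin m),
      Integrable (G.realizedUtility π j) P) (π : Fin m → Equiv.Perm (Fin n)) (j : Fin m) :
    G.expectedUtility P π j ≤ G.expectedUtility P (fun _ => ρ) j := by
  calc G.expectedUtility P π j
      ≤ ∫ ω, ∑ k, G.credential k / (∑ l, G.credential l)
          * G.realizedUtility (fun _ => π k) j ω ∂P :=
        integral_mono (hint π j) (integrable_finsetSum _ fun k _ => (hint _ j).const_mul _)
          fun ω => realizedUtility_le_sum hconv h0 hα π j ω
    _ = ∑ k, G.credential k / (∑ l, G.credential l) * G.expectedUtility P (fun _ => π k) j := by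
        rw [integral_finsetSum _ fun k _ => (hint _ j).const_mul _]
        simp only [integral_const_mul, expectedUtility]
    _ ≤ ∑ k, G.credential k / (∑ l, G.credential l) * G.expectedUtility P (fun _ => ρ) j :=
        Finset.sum_le_sum fun k _ => mul_le_mul_of_nonneg_left
          (expectedUtility_const_le hown hnoise hexch hconv hα hρ hint (π k) j)
          (div_nonneg (h0 k) hα.le)
    _ = G.expectedUtility P (fun _ => ρ) j := by
        rw [← Finset.sum_mul, ← Finset.sum_div, div_self hα.ne', one_mul]

theorem mixedExpectedUtility_eq_sum
    (hint : ∀ (π : Fin m → Equiv.Perm (Fin n)) (j : Fin m),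
      Integrable (G.realizedUtility π j) P)
    (x : Fin m → stdSimplex ℝ (Equiv.Perm (Fin n))) (j : Fin m) :
    G.mixedExpectedUtility P x j = ∑ π : Fin m → Equiv.Perm (Fin n),
      (∏ k, (x k : Equiv.Perm (Fin n) → ℝ) (π k)) * G.expectedUtility P π j := by
  rw [mixedExpectedUtility, integral_finsetSum _ fun π _ => (hint π j).const_mul _]
  simp only [integral_const_mul, expectedUtility]

theorem sum_prod_stdSimplex (x : Fin m → stdSimplex ℝ (Equiv.Perm (Fin n))) :
    ∑ π : Fin m → Equiv.Perm (Fin n), ∏ k, (x k : Equiv.Perm (Fin n) → ℝ) (π k) = 1 := by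
  rw [← Fintype.prod_sum fun k σ => (x k : Equiv.Perm (Fin n) → ℝ) σ]
  exact Finset.prod_eq_one fun k _ => (x k).2.2

/-- Mixing cannot exceed a bound that holds for all pure profiles. -/
theorem mixedExpectedUtility_le
    (hint : ∀ (π : Fin m → Equiv.Perm (Fin n)) (j : Fin m),
      Integrable (G.realizedUtility π j) P)
    {j : Fin m} {c : ℝ} (hc : ∀ π, G.expectedUtility P π j ≤ c)
    (x : Fin m → stdSimplex ℝ (Equiv.Perm (Fin n))) : G.mixedExpectedUtility P x j ≤ c := by
  rw [mixedExpectedUtility_eq_sum hint]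
  calc _ ≤ ∑ π : Fin m → Equiv.Perm (Fin n),
        (∏ k, (x k : Equiv.Perm (Fin n) → ℝ) (π k)) * c :=
        Finset.sum_le_sum fun π _ => mul_le_mul_of_nonneg_left (hc π)
          (Finset.prod_nonneg fun k _ => (x k).2.1 (π k))
    _ = c := by rw [← Finset.sum_mul, sum_prod_stdSimplex, one_mul]

/-- A degenerate mixed profile has the expected utility of the pure profile. -/
theorem mixedExpectedUtility_single
    (hint : ∀ (π : Fin m → Equiv.Perm (Fin n)) (j : Fin m),
      Integrable (G.realizedUtility π j) P)
    (π : Fin m → Equiv.Perm (Fin n)) (j : Fin m) :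
    G.mixedExpectedUtility P
        (fun k => ⟨Pi.single (π k) 1, single_mem_stdSimplex ℝ (π k)⟩) j
      = G.expectedUtility P π j := by
  rw [mixedExpectedUtility_eq_sum hint, Finset.sum_eq_single π]
  · simp
  · intro σ _ hσ
    obtain ⟨k, hk⟩ := Function.ne_iff.1 hσ
    rw [Finset.prod_eq_zero (Finset.mem_univ k) (Pi.single_eq_of_ne hk 1), zero_mul]
  · simp

end ReviewProblem

/-- For completely overlapping ownership, exchangeable noise and convex non-decreasing one-item
utilities: if every owner reports the true ranking `πtrue`, this is a Bayes-Nash equilibrium and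
it is payoff dominant. The last hypothesis says that all expected utilities exist. -/
theorem theorem1 {Ω : Type*} [MeasurableSpace Ω] (P : Measure Ω) [IsProbabilityMeasure P]
    {m n : ℕ} (G : ReviewProblem Ω m n)
    (hown : G.CompletelyOverlapping)
    (hnoise : Measurable G.noise)
    (hexch : IsExchangeable P G.noise)
    (hconv : ∀ j, ConvexOn ℝ Set.univ (G.itemUtility j))
    (hmono : ∀ j, Monotone (G.itemUtility j))
    (hcred : ∀ j, G.credential j ∈ Set.Icc (0 : ℝ) 1)
    (hcred_pos : 0 < ∑ j, G.credential j)
    (πtrue : Equiv.Perm (Fin n)) (htrue : G.IsTrueRanking πtrue)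
    (hint : ∀ (π : Fin m → Equiv.Perm (Fin n)) (j : Fin m),
      Integrable (G.realizedUtility π j) P) :
    G.IsBayesNash P (fun _ => πtrue) ∧ G.IsPayoffDominant P (fun _ => πtrue) := by
  have hle := ReviewProblem.expectedUtility_le_true hown hnoise hexch hconv
    (fun j => (hcred j).1) hcred_pos htrue hint
  -- The bound covers every profile, hence deviations and rival equilibria alike.
  refine ⟨fun j π' => hle _ j, fun j x' => ?_, fun x _ j => ?_⟩
  · rw [ReviewProblem.mixedExpectedUtility_single hint]
    exact ReviewProblem.mixedExpectedUtility_le hint (fun π => hle π j) _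
  · exact ReviewProblem.mixedExpectedUtility_le hint (fun π => hle π j) _
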